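/- A \emph{binary tree} is a finite rooted tree in which every vertex has at most one left child and at most one right child. For a non-empty binary tree $B$ let $\mathrm{LV}(B)$ and $\mathrm{RV}(B)$ be the sets of its left children and of its right children. Let $\mathrm{LO}(B)$ be the number of non-root vertices of the leftmost branch of $B$, i.e. the number of non-root vertices reached from the root by repeatedly passing to the left child as long as there is one; let $\mathrm{RO}(B)$ be the analogous number for the rightmost branch. A (non-empty) \emph{non-ambiguous tree} $T$ is a non-empty binary tree $B$ together with a bijective labelling of $\mathrm{LV}(B)$ by $1,\dots,|\mathrm{LV}(B)|$ and a bijective labelling of $\mathrm{RV}(B)$ by $1,\dots,|\mathrm{RV}(B)|$ such that, whenever $U\neq V$ are two left children (resp. two right children) and $U$ is an ancestor of $V$, the label of $U$ is strictly greater than the label of $V$. Write $\mathrm{LV}(T),\mathrm{RV}(T),\mathrm{LO}(T),\mathrm{RO}(T)$ for the corresponding data of $B$, and let $\mathrm{NAT}$ be the set of non-empty non-ambiguous trees. Let $R$ be a commutative $\mathbb{Q}$-algebra and $\alpha,\beta\in R$ (for instance $R=\mathbb{Q}[\alpha,\beta]$ with $\alpha,\beta$ indeterminates). Then, as an identity of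 formal power series in $R[[x,y]]$, \[ \sum_{T\in \mathrm{NAT}} \frac{x^{|\mathrm{LV}(T)|}\,y^{|\mathrm{RV}(T)|}\,\alpha^{\mathrm{LO}(T)}\,\beta^{\mathrm{RO}(T)}}{|\mathrm{LV}(T)|!\,|\mathrm{RV}(T)|!} =\frac{e^{\alpha x+\beta y}}{\bigl(1-(e^x-1)(e^y-1)\bigr)^{\alpha+\beta}}, \] where the sum on the left converges coefficientwise, $f^{a}:=\exp(a\log f)$ for $a \in R$ and a power series $f$ with constant coefficient $1$, and the denominator on the right is invertible in $R[[x,y]]$. -/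

import Mathlib

namespace NonAmbiguous

/-- The vertices of a binary tree, encoded by their addresses: the path from the root,
`false` for a step to a left child and `true` for a step to a right child. The root is `[]`;
`BinaryTree.nil` stands for an absent child. -/
def vertices : BinaryTree Unit → Finset (List Bool)
  | .nil => ∅
  | .node _ l r =>
      insert [] ((vertices l).image (List.cons false) ∪ (vertices r).image (List.cons true))

/-- The set `LV(B)` of left children of a binary tree. -/
def leftVertices (B : BinaryTree Unit) : Finset (List Bool) :=
  (vertices B).filter fun v => v.getLast? = some false

/-- The set `RV(B)` of right children of a binary tree. -/
def rightVertices (B : BinaryTree Unit) : Finset (List Bool) :=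
  (vertices B).filter fun v => v.getLast? = some true

/-- The number `LO(B)` of non-root vertices of the leftmost branch (the vertices reached from
the root by repeatedly passing to the left child, as long as there is one). -/
def leftmostLength (B : BinaryTree Unit) : ℕ :=
  ((vertices B).filter fun v => v ≠ [] ∧ ∀ d ∈ v, d = false).card

/-- The number `RO(B)` of non-root vertices of the rightmost branch. -/
def rightmostLength (B : BinaryTree Unit) : ℕ :=
  ((vertices B).filter fun v => v ≠ [] ∧ ∀ d ∈ v, d = true).card

/-- `IsDecreasingLabelling S f`: the labels `f` are pairwise distinct, the labels used are exactly
`1, …, |S|`, and a vertex of `S` that is a proper ancestor of another vertex of `S` has the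
larger label. A vertex is an ancestor of another one when its address is a prefix of the other's. -/
def IsDecreasingLabelling (S : Finset (List Bool)) (f : S → ℕ) : Prop :=
  Function.Injective f ∧ Set.range f = Set.Icc 1 S.card ∧
    ∀ u v : S, u ≠ v → (u : List Bool) <+: (v : List Bool) → f v < f u

/-- The non-ambiguous trees of shape `B`. -/
@[ext]
structure NAT (B : BinaryTree Unit) where
  leftLabel : leftVertices B → ℕ
  rightLabel : rightVertices B → ℕ
  left_labelling : IsDecreasingLabelling (leftVertices B) leftLabel
  right_labelling : IsDecreasingLabelling (rightVertices B) rightLabel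

/-- The (non-empty) non-ambiguous trees: a non-empty shape and a labelling of it. -/
abbrev NonAmbiguousTree : Type :=
  Σ B : {B : BinaryTree Unit // B ≠ .nil}, NAT B.1

/-- The shape of a non-ambiguous tree. -/
def NonAmbiguousTree.shape (T : NonAmbiguousTree) : BinaryTree Unit := T.1.1

section GeneratingFunction

variable {R : Type*} [CommRing R] [Algebra ℚ R]

/-- The term
`x ^ |LV(T)| * y ^ |RV(T)| * α ^ LO(T) * β ^ RO(T) / (|LV(T)|! * |RV(T)|!)`
of the generating function; the variables are `x = X 0` and `y = X 1`. -/
noncomputable def natTerm (α β : R) (T : NonAmbiguousTree) : MvPowerSeries (Fin 2) R :=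
  ((((leftVertices T.shape).card.factorial * (rightVertices T.shape).card.factorial : ℕ) : ℚ)⁻¹) •
    (MvPowerSeries.X 0 ^ (leftVertices T.shape).card *
      MvPowerSeries.X 1 ^ (rightVertices T.shape).card *
      MvPowerSeries.C (α ^ leftmostLength T.shape * β ^ rightmostLength T.shape))

/-- `f` is the sum of the family `t` of formal power series: the partial sums over finite
subfamilies converge coefficientwise, each coefficient being eventually constant (the
topology of coefficientwise convergence, for the discrete topology on `R`). -/
def HasFormalSum {ι : Type*} (t : ι → MvPowerSeries (Fin 2) R) (f : MvPowerSeries (Fin 2) R) :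
    Prop :=
  letI : TopologicalSpace R := ⊥
  @HasSum (MvPowerSeries (Fin 2) R) ι _ (MvPowerSeries.WithPiTopology.instTopologicalSpace R) t f
    (SummationFilter.unconditional ι)

/-- The formal exponential `e ^ f`, for `f` with zero constant coefficient. -/
noncomputable def fexp (f : MvPowerSeries (Fin 2) R) : MvPowerSeries (Fin 2) R :=
  (PowerSeries.exp R).subst f

/-- The formal logarithm `log f`, for `f` with constant coefficient `1`
(`PowerSeries.log R` is the series of `log (1 + X)`). -/
noncomputable def flog (f : MvPowerSeries (Fin 2) R) : MvPowerSeries (Fin 2) R :=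
  (PowerSeries.log R).subst (f - 1)

/-- The formal power `f ^ a = e ^ (a log f)`, for `f` with constant coefficient `1` and any
exponent `a` in the coefficient ring. -/
noncomputable def fpow (f : MvPowerSeries (Fin 2) R) (a : R) : MvPowerSeries (Fin 2) R :=
  fexp (MvPowerSeries.C a * flog f)

end GeneratingFunction

end NonAmbiguous

/-! The factorials belong to the hook length formula: a forest `S` has `|S|! / ∏ hook` decreasing
labellings, so all labellings of one shape contribute together the inverse of the product of its
left and right hook lengths. That weight is multiplicative when a tree is cut at its root
(`treeWeight_node`), provided the edge above each subtree is kept.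

Write `x_i` for the variable of one direction, `x_j` for the other and `D` for the denominator.
Subtrees hanging from an edge in direction `i`, the empty one included, with weight `a` per vertex
of their branch in that direction, have generating function `A_i(a) = (e^{x_i} / D)^a`. Indeed `∂_i
A_i(a) = a A_i(a) A_j(1)` with value `1` at `x_i = 0`. On trees, `∂_i` cancels the hook length of
the subtree's root, and cutting there leaves one subtree weighted by `a` and one weighted by `1`
(`edgeCoeff_mul_card`). Comparing coefficients by induction on the degree gives `sum_edgeCoeff_eq`.
The whole tree then contributes `A_0(α) A_1(β)`, which is the right-hand side. -/

namespace NonAmbiguous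

open MvPowerSeries

/-! ### Chain rule for substitution into a one-variable power series. -/

section Calculus

variable {σ R : Type*} [CommRing R]

/-- As `g` has no constant term, `g ^ d` has no terms of degree below `d`. This reduces questions
about `f` to polynomials. -/
theorem coeff_subst_trunc {g : MvPowerSeries σ R} (hg : constantCoeff g = 0) (f : PowerSeries R)
    {e : σ →₀ ℕ} {n : ℕ} (hn : e.degree < n) :
    coeff e (f.subst g) = coeff e ((PowerSeries.trunc n f : PowerSeries R).subst g) := by
  have hs : PowerSeries.HasSubst g := .of_constantCoeff_zero hg
  rw [PowerSeries.coeff_subst hs, PowerSeries.coeff_subst hs]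
  refine finsum_congr fun d ↦ ?_
  rcases lt_or_ge d n with hd | hd
  · rw [PowerSeries.coeff_coe_trunc_of_lt hd]
  · rw [coeff_eq_zero_of_constantCoeff_nilpotent (m := 1) (by simpa using hg) (by lia)]
    simp

theorem pderiv_subst {g : MvPowerSeries σ R} (hg : constantCoeff g = 0) (f : PowerSeries R)
    (i : σ) :
    pderiv R i (f.subst g) = (PowerSeries.derivative R f).subst g * pderiv R i g := by
  classical
  have hs : PowerSeries.HasSubst g := .of_constantCoeff_zero hg
  ext n
  -- Differentiation lowers degrees by one: truncating `f` at `N + 1` truncates its derivative at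
  -- `N`.
  set N := n.degree + 1 with hN
  have h1 : (n + Finsupp.single i 1).degree < N + 1 := by simp [hN, map_add]
  rw [coeff_pderiv, coeff_subst_trunc hg f h1, ← coeff_pderiv, PowerSeries.subst_coe hs,
    Derivation.comp_aeval_eq, smul_eq_mul, ← PowerSeries.subst_coe hs,
    ← PowerSeries.trunc_derivative, coeff_mul, coeff_mul]
  refine Finset.sum_congr rfl fun p hp ↦ ?_
  have hp' : p.1.degree < N := by
    have := congrArg Finsupp.degree (Finset.HasAntidiagonal.mem_antidiagonal.mp hp)
    rw [map_add] at this
    lia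
  rw [← coeff_subst_trunc hg _ hp']

theorem dvd_subst {f : MvPowerSeries σ R} (hf : constantCoeff f = 0) {p : PowerSeries R}
    (hp : PowerSeries.constantCoeff p = 0) : f ∣ p.subst f := by
  have hs : PowerSeries.HasSubst f := .of_constantCoeff_zero hf
  obtain ⟨q, rfl⟩ := PowerSeries.X_dvd_iff.mpr hp
  exact ⟨q.subst f, by rw [PowerSeries.subst_mul hs, PowerSeries.subst_X hs]⟩

end Calculus

/-! ### Formal exponential and logarithm; the closed form and its differential equation. -/

section ExpLog

variable {R : Type*} [CommRing R] [Algebra ℚ R]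

/-- Source of the functional equations below: move everything into one product and check that its
derivatives vanish. -/
theorem eq_one_of_pderiv_eq_zero {f : MvPowerSeries (Fin 2) R} (hf : ∀ i, pderiv R i f = 0)
    (hc : constantCoeff f = 1) : f = 1 := by
  have : IsAddTorsionFree R := .of_module_rat R
  exact pderiv.ext (fun i ↦ by rw [hf, pderiv_one]) (by simp [hc])

theorem constantCoeff_fexp {f : MvPowerSeries (Fin 2) R} (hf : constantCoeff f = 0) :
    constantCoeff (fexp f) = 1 := by
  have hs : PowerSeries.HasSubst f := .of_constantCoeff_zero hf
  have h := PowerSeries.constantCoeff_subst_eq_zero hf (PowerSeries.exp R - PowerSeries.C 1)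
    (by simp)
  rw [PowerSeries.subst_sub hs, PowerSeries.subst_C, map_sub, constantCoeff_C, sub_eq_zero] at h
  exact h

theorem pderiv_fexp {f : MvPowerSeries (Fin 2) R} (hf : constantCoeff f = 0) (i : Fin 2) :
    pderiv R i (fexp f) = fexp f * pderiv R i f := by
  rw [fexp, pderiv_subst hf, PowerSeries.derivative_exp]

theorem fexp_mul_fexp_neg {f : MvPowerSeries (Fin 2) R} (hf : constantCoeff f = 0) :
    fexp f * fexp (-f) = 1 := by
  have hf' : constantCoeff (-f) = 0 := by simp [hf]
  refine eq_one_of_pderiv_eq_zero (fun i ↦ ?_) ?_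
  · rw [Derivation.leibniz, pderiv_fexp hf, pderiv_fexp hf', map_neg, smul_eq_mul, smul_eq_mul]
    ring
  · rw [map_mul, constantCoeff_fexp hf, constantCoeff_fexp hf', one_mul]

theorem fexp_add {f g : MvPowerSeries (Fin 2) R} (hf : constantCoeff f = 0)
    (hg : constantCoeff g = 0) : fexp (f + g) = fexp f * fexp g := by
  have hfg : constantCoeff (f + g) = 0 := by simp [hf, hg]
  have hfg' : constantCoeff (-(f + g)) = 0 := by simp [hf, hg]
  have h : fexp (-(f + g)) * (fexp f * fexp g) = 1 := by
    refine eq_one_of_pderiv_eq_zero (fun i ↦ ?_) ?_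
    · rw [Derivation.leibniz, Derivation.leibniz, pderiv_fexp hf, pderiv_fexp hg,
        pderiv_fexp hfg', map_neg, map_add]
      simp only [smul_eq_mul]
      ring
    · simp [constantCoeff_fexp, hf, hg]
  calc fexp (f + g) = fexp (f + g) * (fexp (-(f + g)) * (fexp f * fexp g)) := by rw [h, mul_one]
    _ = fexp f * fexp g := by rw [← mul_assoc, fexp_mul_fexp_neg hfg, one_mul]

theorem constantCoeff_flog {f : MvPowerSeries (Fin 2) R} (hf : constantCoeff f = 1) :
    constantCoeff (flog f) = 0 :=
  PowerSeries.constantCoeff_subst_eq_zero (by simp [hf]) _ PowerSeries.constantCoeff_log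

theorem derivative_log_mul_one_add_X :
    PowerSeries.derivative R (PowerSeries.log R) * (1 + PowerSeries.X) = 1 := by
  rw [PowerSeries.deriv_log, mul_add, mul_one]
  ext (_ | n)
  · simp
  · simp [PowerSeries.coeff_succ_mul_X, PowerSeries.coeff_one, pow_succ]

theorem mul_pderiv_flog {f : MvPowerSeries (Fin 2) R} (hf : constantCoeff f = 1) (i : Fin 2) :
    f * pderiv R i (flog f) = pderiv R i f := by
  have h0 : constantCoeff (f - 1) = 0 := by simp [hf]
  have hs : PowerSeries.HasSubst (f - 1) := .of_constantCoeff_zero h0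
  have h := congrArg (PowerSeries.subst (f - 1)) (derivative_log_mul_one_add_X (R := R))
  have h1 : PowerSeries.subst (f - 1) (1 : PowerSeries R) = 1 := by
    rw [← map_one PowerSeries.C, PowerSeries.subst_C, map_one]
  rw [PowerSeries.subst_mul hs, PowerSeries.subst_add hs, h1, PowerSeries.subst_X hs,
    add_sub_cancel] at h
  rw [flog, pderiv_subst h0, map_sub, pderiv_one, sub_zero, ← mul_assoc, mul_comm f, h, one_mul]

/-- This is `exp (log f) = f`, in a form where differentiation replaces composing the two series. -/
theorem mul_fexp_neg_flog {f : MvPowerSeries (Fin 2) R} (hf : constantCoeff f = 1) :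
    f * fexp (-flog f) = 1 := by
  have hl : constantCoeff (-flog f) = 0 := by simp [constantCoeff_flog hf]
  refine eq_one_of_pderiv_eq_zero (fun i ↦ ?_) ?_
  · rw [Derivation.leibniz, pderiv_fexp hl, map_neg, smul_eq_mul, smul_eq_mul,
      ← mul_pderiv_flog hf]
    ring
  · rw [map_mul, hf, constantCoeff_fexp hl, one_mul]

theorem isUnit_fpow {f : MvPowerSeries (Fin 2) R} (hf : constantCoeff f = 1) (a : R) :
    IsUnit (fpow f a) :=
  .of_mul_eq_one _ (fexp_mul_fexp_neg (by simp [constantCoeff_flog hf]))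

theorem inverse_fpow {f : MvPowerSeries (Fin 2) R} (hf : constantCoeff f = 1) (a : R) :
    Ring.inverse (fpow f a) = fexp (-(C a * flog f)) :=
  have h : fpow f a * fexp (-(C a * flog f)) = 1 :=
    fexp_mul_fexp_neg (by simp [constantCoeff_flog hf])
  (isUnit_fpow hf a).mul_left_cancel (by rw [Ring.mul_inverse_cancel _ (isUnit_fpow hf a), h])

theorem dvd_fexp_sub_one {f : MvPowerSeries (Fin 2) R} (hf : constantCoeff f = 0) :
    f ∣ fexp f - 1 := by
  have hs : PowerSeries.HasSubst f := .of_constantCoeff_zero hf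
  have h := dvd_subst hf (p := PowerSeries.exp R - PowerSeries.C 1) (by simp)
  rwa [PowerSeries.subst_sub hs, PowerSeries.subst_C, map_one] at h

theorem sub_one_dvd_flog {f : MvPowerSeries (Fin 2) R} (hf : constantCoeff f = 1) :
    f - 1 ∣ flog f :=
  dvd_subst (by simp [hf]) PowerSeries.constantCoeff_log

/-- The series `1 - (e ^ x - 1) * (e ^ y - 1)`. -/
noncomputable def denominator (R : Type*) [CommRing R] [Algebra ℚ R] :
    MvPowerSeries (Fin 2) R :=
  1 - (fexp (X 0) - 1) * (fexp (X 1) - 1)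

theorem constantCoeff_denominator : constantCoeff (denominator R) = 1 := by
  simp [denominator, constantCoeff_fexp]

/-- The logarithm of `e ^ (x i) / (1 - (e ^ x - 1) * (e ^ y - 1))`. -/
noncomputable def logBranch (R : Type*) [CommRing R] [Algebra ℚ R] (i : Fin 2) :
    MvPowerSeries (Fin 2) R :=
  X i - flog (denominator R)

theorem constantCoeff_logBranch (i : Fin 2) : constantCoeff (logBranch R i) = 0 := by
  simp [logBranch, constantCoeff_flog constantCoeff_denominator]

/-- The series `(e ^ (x i) / (1 - (e ^ x - 1) * (e ^ y - 1))) ^ a`. -/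
noncomputable def branchSeries (a : R) (i : Fin 2) : MvPowerSeries (Fin 2) R :=
  fexp (C a * logBranch R i)

theorem denominator_mul_branchSeries_one (i : Fin 2) :
    denominator R * branchSeries 1 i = fexp (X i) := by
  rw [branchSeries, map_one, one_mul, logBranch, sub_eq_add_neg, fexp_add (by simp)
    (by simp [constantCoeff_flog constantCoeff_denominator]), mul_left_comm,
    mul_fexp_neg_flog constantCoeff_denominator, mul_one]

/-- For `i = 0`: `1 + e^x (e^y - 1) / D = e^y / D`. The proof multiplies through by the unit `D`. -/
theorem pderiv_logBranch {i j : Fin 2} (hij : i ≠ j) :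
    pderiv R i (logBranch R i) = branchSeries 1 j := by
  have hu : fexp (-flog (denominator R)) * denominator R = 1 := by
    rw [mul_comm, mul_fexp_neg_flog constantCoeff_denominator]
  refine (IsUnit.of_mul_eq_one_right _ hu).mul_left_cancel ?_
  rw [denominator_mul_branchSeries_one, logBranch, map_sub, pderiv_X_self, mul_sub,
    mul_pderiv_flog constantCoeff_denominator]
  have hX : ∀ k : Fin 2, constantCoeff (X k : MvPowerSeries (Fin 2) R) = 0 := by simp
  fin_cases i <;> fin_cases j <;> first | exact absurd rfl hij | skip
  all_goals
    simp only [denominator, map_sub, Derivation.leibniz, pderiv_one, pderiv_fexp (hX _),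
      pderiv_X, smul_eq_mul]
    simp
    ring

theorem pderiv_branchSeries (a : R) {i j : Fin 2} (hij : i ≠ j) :
    pderiv R i (branchSeries a i) = C a * (branchSeries a i * branchSeries 1 j) := by
  rw [branchSeries, pderiv_fexp (by simp [constantCoeff_logBranch]), Derivation.leibniz,
    pderiv_C, pderiv_logBranch hij]
  simp only [smul_eq_mul]
  ring

/-- The initial condition: at `x_i = 0` the denominator is `1`, so the logarithm vanishes. -/
theorem X_dvd_branchSeries_sub_one (a : R) (i : Fin 2) : X i ∣ branchSeries a i - 1 := by
  have hX : ∀ k : Fin 2, constantCoeff (X k : MvPowerSeries (Fin 2) R) = 0 := by simp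
  have h : (X i : MvPowerSeries (Fin 2) R) ∣ denominator R - 1 := by
    rw [denominator, sub_sub_cancel_left, dvd_neg]
    have h := dvd_fexp_sub_one (hX i)
    fin_cases i
    exacts [h.mul_right _, h.mul_left _]
  exact (((dvd_refl _).sub (h.trans (sub_one_dvd_flog constantCoeff_denominator))).mul_left
    _).trans
    (dvd_fexp_sub_one (by simp [constantCoeff_flog constantCoeff_denominator]))

theorem coeff_branchSeries_of_eq_zero (a : R) (i : Fin 2) {d : Fin 2 →₀ ℕ} (hd : d i = 0) :
    coeff d (branchSeries a i) = if d = 0 then 1 else 0 := by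
  have h := X_dvd_iff.mp (X_dvd_branchSeries_sub_one a i) d hd
  rwa [map_sub, coeff_one, sub_eq_zero] at h

theorem coeff_branchSeries_add_single (a : R) {i j : Fin 2} (hij : i ≠ j) (d : Fin 2 →₀ ℕ) :
    coeff (d + Finsupp.single i 1) (branchSeries a i) * (d i + 1) =
      a * coeff d (branchSeries a i * branchSeries 1 j) := by
  rw [← coeff_pderiv, pderiv_branchSeries a hij, coeff_C_mul]

theorem fexp_mul_inverse_fpow_denominator (α β : R) :
    fexp (C α * X 0 + C β * X 1) * Ring.inverse (fpow (denominator R) (α + β)) =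
      branchSeries α 0 * branchSeries β 1 := by
  have hd := constantCoeff_flog (constantCoeff_denominator (R := R))
  rw [inverse_fpow constantCoeff_denominator, branchSeries, branchSeries, ← fexp_add, ← fexp_add]
  · congr 1
    simp only [logBranch, map_add]
    ring
  all_goals simp [constantCoeff_logBranch, hd]

end ExpLog

end NonAmbiguous

namespace NonAmbiguous

/-! ### Hook length formula for decreasing labellings. -/

section HookFormula

/-- The hook length of `v` in `S`: the number of descendants of `v` in `S`. -/
def hook (S : Finset (List Bool)) (v : List Bool) : ℕ :=
  (S.filter fun w => v <+: w).card

/-- The elements of `S` without a proper ancestor in `S`. -/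
def roots (S : Finset (List Bool)) : Finset (List Bool) :=
  S.filter fun r => ∀ u ∈ S, u <+: r → u = r

/-- A decreasing labelling of `S`, extended by zero to all addresses. -/
structure IsExtendedLabelling (S : Finset (List Bool)) (f : List Bool → ℕ) : Prop where
  eq_zero : ∀ v, v ∉ S → f v = 0
  one_le : ∀ v ∈ S, 1 ≤ f v
  le_card : ∀ v ∈ S, f v ≤ S.card
  inj : ∀ u ∈ S, ∀ v ∈ S, f u = f v → u = v
  lt : ∀ u ∈ S, ∀ v ∈ S, u ≠ v → u <+: v → f v < f u

/-- Every element lies below exactly one root, its shortest prefix in `S`; uniqueness holds because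
two prefixes of one address are comparable. -/
theorem sum_roots_hook (S : Finset (List Bool)) : ∑ r ∈ roots S, hook S r = S.card := by
  have h : S = (roots S).biUnion fun r => S.filter fun w => r <+: w := by
    ext v
    simp only [Finset.mem_biUnion, Finset.mem_filter]
    refine ⟨fun hv ↦ ?_, fun ⟨_, _, hv, _⟩ ↦ hv⟩
    obtain ⟨r, hr, hmin⟩ := Finset.exists_min_image (S.filter fun u => u <+: v) List.length
      ⟨v, by simp [hv]⟩
    rw [Finset.mem_filter] at hr
    refine ⟨r, Finset.mem_filter.mpr ⟨hr.1, fun u hu hur ↦ ?_⟩, hv, hr.2⟩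
    exact hur.eq_of_length_le (hmin u (by simp [hu, hur.trans hr.2]))
  conv_rhs => rw [h]
  rw [Finset.card_biUnion]
  · rfl
  · intro r hr r' hr' hne
    rw [Finset.mem_coe, roots, Finset.mem_filter] at hr hr'
    rw [Function.onFun, Finset.disjoint_left]
    intro v hv hv'
    rw [Finset.mem_filter] at hv hv'
    rcases List.prefix_or_prefix_of_prefix hv.2 hv'.2 with h | h
    · exact hne (hr'.2 r hr.1 h)
    · exact hne (hr.2 r' hr'.1 h).symm

theorem hook_erase {S : Finset (List Bool)} {r v : List Bool} (hr : r ∈ roots S)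
    (hv : v ∈ S.erase r) : hook (S.erase r) v = hook S v := by
  rw [roots, Finset.mem_filter] at hr
  rw [Finset.mem_erase] at hv
  refine congrArg Finset.card (Finset.ext fun w ↦ ?_)
  simp only [Finset.mem_filter, Finset.mem_erase]
  refine ⟨fun h ↦ ⟨h.1.2, h.2⟩, fun h ↦ ⟨⟨?_, h.1⟩, h.2⟩⟩
  rintro rfl
  exact hv.1 (hr.2 v hv.2 h.2)

namespace IsExtendedLabelling

variable {S : Finset (List Bool)} {f : List Bool → ℕ} {r : List Bool}

theorem image_eq (hf : IsExtendedLabelling S f) : S.image f = Finset.Icc 1 S.card := by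
  refine Finset.eq_of_subset_of_card_le (fun n hn ↦ ?_) ?_
  · obtain ⟨v, hv, rfl⟩ := Finset.mem_image.mp hn
    exact Finset.mem_Icc.mpr ⟨hf.one_le v hv, hf.le_card v hv⟩
  · rw [Nat.card_Icc, Finset.card_image_of_injOn fun u hu v hv h ↦ hf.inj u hu v hv h]
    lia

/-- A proper ancestor of the vertex with the top label would need a larger label. -/
theorem exists_eq_card (hf : IsExtendedLabelling S f) (hS : S.Nonempty) :
    ∃ r ∈ roots S, f r = S.card := by
  have h : S.card ∈ S.image f := by
    rw [hf.image_eq, Finset.mem_Icc]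
    exact ⟨hS.card_pos, le_rfl⟩
  obtain ⟨r, hr, hfr⟩ := Finset.mem_image.mp h
  refine ⟨r, Finset.mem_filter.mpr ⟨hr, fun u hu hur ↦ ?_⟩, hfr⟩
  by_contra hne
  have h1 := hf.lt u hu r hr hne hur
  have h2 := hf.le_card u hu
  lia

theorem erase (hf : IsExtendedLabelling S f) (hr : r ∈ S) (hfr : f r = S.card) :
    IsExtendedLabelling (S.erase r) (Function.update f r 0) := by
  have hval : ∀ v ∈ S.erase r, Function.update f r 0 v = f v := fun v hv ↦
    Function.update_of_ne (Finset.ne_of_mem_erase hv) _ _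
  constructor
  · intro v hv
    by_cases hvr : v = r
    · simp [hvr]
    · rw [Function.update_of_ne hvr]
      exact hf.eq_zero v fun h ↦ hv (Finset.mem_erase.mpr ⟨hvr, h⟩)
  · intro v hv
    rw [hval v hv]
    exact hf.one_le v (Finset.mem_of_mem_erase hv)
  · intro v hv
    rw [hval v hv, Finset.card_erase_of_mem hr]
    have h1 := hf.le_card v (Finset.mem_of_mem_erase hv)
    have h2 : f v ≠ S.card := fun h ↦ Finset.ne_of_mem_erase hv
      (hf.inj v (Finset.mem_of_mem_erase hv) r hr (h.trans hfr.symm))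
    lia
  · intro u hu v hv
    rw [hval u hu, hval v hv]
    exact hf.inj u (Finset.mem_of_mem_erase hu) v (Finset.mem_of_mem_erase hv)
  · intro u hu v hv
    rw [hval u hu, hval v hv]
    exact hf.lt u (Finset.mem_of_mem_erase hu) v (Finset.mem_of_mem_erase hv)

theorem update (hr : r ∈ roots S) (hf : IsExtendedLabelling (S.erase r) f) :
    IsExtendedLabelling S (Function.update f r S.card) := by
  rw [roots, Finset.mem_filter] at hr
  have hle : ∀ v ∈ S, v ≠ r → f v < S.card := fun v hv hvr ↦ by
    have h1 := hf.le_card v (Finset.mem_erase.mpr ⟨hvr, hv⟩)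
    rw [Finset.card_erase_of_mem hr.1] at h1
    have h2 : 0 < S.card := Finset.card_pos.mpr ⟨r, hr.1⟩
    lia
  have hne : ∀ {v}, v ≠ r → Function.update f r S.card v = f v := fun h ↦
    Function.update_of_ne h _ _
  constructor
  · intro v hv
    rw [hne (by rintro rfl; exact hv hr.1)]
    exact hf.eq_zero v fun h ↦ hv (Finset.mem_of_mem_erase h)
  · intro v hv
    by_cases hvr : v = r
    · subst hvr
      simpa using Finset.card_pos.mpr ⟨v, hv⟩
    · rw [hne hvr]
      exact hf.one_le v (Finset.mem_erase.mpr ⟨hvr, hv⟩)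
  · intro v hv
    by_cases hvr : v = r
    · simp [hvr]
    · rw [hne hvr]
      exact (hle v hv hvr).le
  · intro u hu v hv
    by_cases hur : u = r <;> by_cases hvr : v = r
    · simp [hur, hvr]
    · rw [hne hvr, hur, Function.update_self]
      exact fun h ↦ absurd h (hle v hv hvr).ne'
    · rw [hne hur, hvr, Function.update_self]
      exact fun h ↦ absurd h (hle u hu hur).ne
    · rw [hne hur, hne hvr]
      exact hf.inj u (Finset.mem_erase.mpr ⟨hur, hu⟩) v (Finset.mem_erase.mpr ⟨hvr, hv⟩)
  · intro u hu v hv huv hpre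
    by_cases hvr : v = r
    · subst hvr
      exact absurd (hr.2 u hu hpre) huv
    · rw [hne hvr]
      by_cases hur : u = r
      · rw [hur, Function.update_self]
        exact hle v hv hvr
      · rw [hne hur]
        exact hf.lt u (Finset.mem_erase.mpr ⟨hur, hu⟩) v (Finset.mem_erase.mpr ⟨hvr, hv⟩) huv hpre

end IsExtendedLabelling

/-- The hook length formula for forests of addresses. -/
theorem exists_finset_extendedLabelling (S : Finset (List Bool)) :
    ∃ F : Finset (List Bool → ℕ), (∀ f, f ∈ F ↔ IsExtendedLabelling S f) ∧
      F.card * ∏ v ∈ S, hook S v = S.card.factorial := by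
  classical
  induction hn : S.card generalizing S with
  | zero =>
    obtain rfl := Finset.card_eq_zero.mp hn
    refine ⟨{0}, fun f ↦ ?_, by simp⟩
    rw [Finset.mem_singleton]
    refine ⟨?_, fun h ↦ funext fun v ↦ h.eq_zero v (by simp)⟩
    rintro rfl
    constructor <;> simp
  | succ n ih =>
    have hcard : ∀ r ∈ roots S, (S.erase r).card = n := fun r hr ↦ by
      rw [Finset.card_erase_of_mem (Finset.mem_filter.mp hr).1, hn, Nat.add_sub_cancel]
    -- A labelling of `S` amounts to a root `r` carrying the top label and a labelling of `S.erase
    -- r`.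
    choose! F hF hFcard using fun r hr ↦ ih (S.erase r) (hcard r hr)
    refine ⟨(roots S).biUnion fun r ↦ (F r).image fun g ↦ Function.update g r S.card,
      fun f ↦ ?_, ?_⟩
    · simp only [Finset.mem_biUnion, Finset.mem_image]
      constructor
      · rintro ⟨r, hr, g, hg, rfl⟩
        exact ((hF r hr g).mp hg).update hr
      · intro hf
        obtain ⟨r, hr, hfr⟩ := hf.exists_eq_card (Finset.card_pos.mp (by lia))
        refine ⟨r, hr, Function.update f r 0,
          (hF r hr _).mpr (hf.erase (Finset.mem_filter.mp hr).1 hfr), ?_⟩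
        simp [← hfr]
    · rw [Finset.card_biUnion, Finset.sum_mul]
      · have hterm : ∀ r ∈ roots S,
            ((F r).image fun g ↦ Function.update g r S.card).card * ∏ v ∈ S, hook S v =
              hook S r * n.factorial := by
          intro r hr
          rw [Finset.card_image_of_injOn, ← Finset.mul_prod_erase S _ (Finset.mem_filter.mp hr).1,
            ← hFcard r hr, Finset.prod_congr rfl fun v hv ↦ hook_erase hr hv]
          · ring
          · intro g hg g' hg' h
            -- Extension by zero fixes the value at `r`, so `g` is recovered by resetting it.
            have hz : ∀ g ∈ F r, g r = 0 := fun g hg ↦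
              ((hF r hr g).mp hg).eq_zero r (by simp)
            have h' := congrArg (fun k ↦ Function.update k r 0) h
            simp only [Function.update_idem] at h'
            rwa [← hz g hg, Function.update_eq_self, hz g hg, ← hz g' hg',
              Function.update_eq_self] at h'
        rw [Finset.sum_congr rfl hterm, ← Finset.sum_mul, sum_roots_hook, hn, Nat.factorial_succ]
      · intro r hr r' hr' hne
        rw [Finset.mem_coe] at hr hr'
        rw [Function.onFun, Finset.disjoint_left]
        simp only [Finset.mem_image]
        rintro f ⟨g, hg, rfl⟩ ⟨g', hg', h⟩
        -- A common labelling would take its top label at both `r` and `r'`.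
        have hL := ((hF r hr g).mp hg).update hr
        refine hne (hL.inj r (Finset.mem_filter.mp hr).1 r' (Finset.mem_filter.mp hr').1 ?_)
        rw [← h, Function.update_self, h, Function.update_self]

/-- Restriction identifies extended labellings with labellings. -/
def extendedLabellingEquiv (S : Finset (List Bool)) :
    {f // IsExtendedLabelling S f} ≃ {f : S → ℕ // IsDecreasingLabelling S f} where
  toFun f := ⟨fun v ↦ f.1 v, fun u v h ↦ Subtype.ext (f.2.inj u u.2 v v.2 h), by
    ext n
    have h := Finset.ext_iff.mp f.2.image_eq n
    rw [Finset.mem_image, Finset.mem_Icc] at h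
    rw [Set.mem_Icc, ← h]
    simp, fun u v huv hpre ↦ f.2.lt u u.2 v v.2 (fun h ↦ huv (Subtype.ext h)) hpre⟩
  invFun f := ⟨fun v ↦ if hv : v ∈ S then f.1 ⟨v, hv⟩ else 0, by
    obtain ⟨f, hinj, hrange, hlt⟩ := f
    have hmem : ∀ v : S, f v ∈ Set.Icc 1 S.card := fun v ↦ hrange ▸ Set.mem_range_self v
    constructor
    · intro v hv
      simp [hv]
    · intro v hv
      simpa [hv] using (hmem ⟨v, hv⟩).1
    · intro v hv
      simpa [hv] using (hmem ⟨v, hv⟩).2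
    · intro u hu v hv h
      simp only [hu, hv, dite_true] at h
      exact congrArg Subtype.val (hinj h)
    · intro u hu v hv huv hpre
      simp only [hu, hv, dite_true]
      exact hlt ⟨u, hu⟩ ⟨v, hv⟩ (by simpa using huv) hpre⟩
  left_inv f := by
    ext v
    by_cases hv : v ∈ S
    · simp [hv]
    · simp [hv, f.2.eq_zero v hv]
  right_inv f := by
    ext v
    simp

theorem finite_isDecreasingLabelling (S : Finset (List Bool)) :
    Finite {f : S → ℕ // IsDecreasingLabelling S f} := by
  obtain ⟨F, hF, -⟩ := exists_finset_extendedLabelling S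
  exact .of_equiv F ((Equiv.subtypeEquivRight hF).trans (extendedLabellingEquiv S))

theorem card_isDecreasingLabelling_mul_prod_hook (S : Finset (List Bool)) :
    Nat.card {f : S → ℕ // IsDecreasingLabelling S f} * ∏ v ∈ S, hook S v =
      S.card.factorial := by
  obtain ⟨F, hF, h⟩ := exists_finset_extendedLabelling S
  rw [← h, ← Nat.card_congr ((Equiv.subtypeEquivRight hF).trans (extendedLabellingEquiv S))]
  simp

end HookFormula

end NonAmbiguous

namespace NonAmbiguous

/-! ### Hooks, degrees and branches under cutting at the root. -/

section Statistics

theorem hook_image_cons_union (S T : Finset (List Bool)) {b b' : Bool} (hb : b ≠ b')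
    (v : List Bool) :
    hook (S.image (List.cons b) ∪ T.image (List.cons b')) (b :: v) = hook S v := by
  rw [hook, hook, ← Finset.card_image_of_injective (S.filter fun w => v <+: w)
    (List.cons_injective (a := b))]
  congr 1
  ext w
  simp only [Finset.mem_filter, Finset.mem_union, Finset.mem_image]
  constructor
  · rintro ⟨⟨w, hw, rfl⟩ | ⟨w, hw, rfl⟩, h⟩
    · exact ⟨w, ⟨hw, (List.cons_prefix_cons.mp h).2⟩, rfl⟩
    · exact absurd (List.cons_prefix_cons.mp h).1 hb
  · rintro ⟨w, ⟨hw, h⟩, rfl⟩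
    exact ⟨.inl ⟨w, hw, rfl⟩, List.cons_prefix_cons.mpr ⟨rfl, h⟩⟩

theorem disjoint_image_cons (S T : Finset (List Bool)) :
    Disjoint (S.image (List.cons false)) (T.image (List.cons true)) := by
  rw [Finset.disjoint_left]
  simp only [Finset.mem_image]
  rintro _ ⟨v, -, rfl⟩ ⟨w, -, h⟩
  simp at h

theorem card_image_cons_union (S T : Finset (List Bool)) :
    (S.image (List.cons false) ∪ T.image (List.cons true)).card = S.card + T.card := by
  rw [Finset.card_union_of_disjoint (disjoint_image_cons S T),
    Finset.card_image_of_injective _ List.cons_injective,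
    Finset.card_image_of_injective _ List.cons_injective]

/-- The product of all hook lengths of `S`. -/
def hookProd (S : Finset (List Bool)) : ℕ := ∏ v ∈ S, hook S v

theorem hookProd_image_cons_union (S T : Finset (List Bool)) :
    hookProd (S.image (List.cons false) ∪ T.image (List.cons true)) =
      hookProd S * hookProd T := by
  rw [hookProd, Finset.prod_union (disjoint_image_cons S T),
    Finset.prod_image fun _ _ _ _ h ↦ List.cons_injective h,
    Finset.prod_image fun _ _ _ _ h ↦ List.cons_injective h]
  congr 1
  · exact Finset.prod_congr rfl fun v _ ↦ hook_image_cons_union S T (by simp) v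
  · refine Finset.prod_congr rfl fun v _ ↦ ?_
    rw [Finset.union_comm]
    exact hook_image_cons_union T S (by simp) v

/-- The root address is a prefix of every address, and no other address is a prefix of it. -/
theorem hookProd_insert_nil {S : Finset (List Bool)} (hS : [] ∉ S) :
    hookProd (insert [] S) = (S.card + 1) * hookProd S := by
  rw [hookProd, Finset.prod_insert hS]
  congr 1
  · simp [hook, Finset.card_insert_of_notMem hS]
  · refine Finset.prod_congr rfl fun v hv ↦ ?_
    have hv' : v ≠ [] := fun h ↦ hS (h ▸ hv)
    rw [hook, Finset.filter_insert, if_neg (by simpa using hv'), hook]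

theorem hookProd_ne_zero (S : Finset (List Bool)) : hookProd S ≠ 0 :=
  Finset.prod_ne_zero_iff.mpr fun v hv ↦
    (Finset.card_pos.mpr ⟨v, Finset.mem_filter.mpr ⟨hv, List.prefix_rfl⟩⟩).ne'

/-- The vertices of `B` reached by a final step in direction `c`. -/
def dirVertices (c : Bool) (B : BinaryTree Unit) : Finset (List Bool) :=
  (vertices B).filter fun v => v.getLast? = some c

/-- The vertices of `B` reached by a final step in direction `c`, when the root of `B` is itself
reached by a step in direction `b`. -/
def edgeVertices (c b : Bool) (B : BinaryTree Unit) : Finset (List Bool) :=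
  (vertices B).filter fun v => (b :: v).getLast? = some c

theorem edgeVertices_nil (c b : Bool) : edgeVertices c b .nil = ∅ := rfl

theorem dirVertices_node (c : Bool) (l r : BinaryTree Unit) :
    dirVertices c (.node () l r) =
      (edgeVertices c false l).image (List.cons false) ∪
        (edgeVertices c true r).image (List.cons true) := by
  simp only [dirVertices, edgeVertices, vertices, Finset.filter_insert, Finset.filter_union,
    Finset.filter_image]
  simp

theorem edgeVertices_of_ne {c b : Bool} (h : b ≠ c) (B : BinaryTree Unit) :
    edgeVertices c b B = dirVertices c B := by
  refine Finset.filter_congr fun v _ ↦ ?_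
  cases v <;> simp [h]

theorem nil_mem_vertices {B : BinaryTree Unit} (hB : B ≠ .nil) : [] ∈ vertices B := by
  cases B
  · exact absurd rfl hB
  · simp [vertices]

theorem edgeVertices_self (c : Bool) {B : BinaryTree Unit} (hB : B ≠ .nil) :
    edgeVertices c c B = insert [] (dirVertices c B) := by
  ext v
  cases v <;> simp [edgeVertices, dirVertices, nil_mem_vertices hB]

theorem nil_notMem_dirVertices (c : Bool) (B : BinaryTree Unit) : [] ∉ dirVertices c B := by
  simp [dirVertices]

theorem card_edgeVertices_self (c : Bool) {B : BinaryTree Unit} (hB : B ≠ .nil) :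
    (edgeVertices c c B).card = (dirVertices c B).card + 1 := by
  rw [edgeVertices_self c hB, Finset.card_insert_of_notMem (nil_notMem_dirVertices c B)]

theorem hookProd_edgeVertices_self (c : Bool) {B : BinaryTree Unit} (hB : B ≠ .nil) :
    hookProd (edgeVertices c c B) = ((dirVertices c B).card + 1) * hookProd (dirVertices c B) := by
  rw [edgeVertices_self c hB, hookProd_insert_nil (nil_notMem_dirVertices c B)]

theorem card_dirVertices_node (c : Bool) (l r : BinaryTree Unit) :
    (dirVertices c (.node () l r)).card =
      (edgeVertices c false l).card + (edgeVertices c true r).card := by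
  rw [dirVertices_node, card_image_cons_union]

theorem hookProd_dirVertices_node (c : Bool) (l r : BinaryTree Unit) :
    hookProd (dirVertices c (.node () l r)) =
      hookProd (edgeVertices c false l) * hookProd (edgeVertices c true r) := by
  rw [dirVertices_node, hookProd_image_cons_union]

/-- The number of non-root vertices of the branch of `B` in direction `c`. -/
def branchLength (c : Bool) (B : BinaryTree Unit) : ℕ :=
  ((vertices B).filter fun v => v ≠ [] ∧ ∀ d ∈ v, d = c).card

/-- The number of vertices of the branch of `B` in direction `c`. -/
def branchCard (c : Bool) (B : BinaryTree Unit) : ℕ :=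
  ((vertices B).filter fun v => ∀ d ∈ v, d = c).card

theorem branchCard_nil (c : Bool) : branchCard c .nil = 0 := rfl

theorem branchCard_of_ne_nil (c : Bool) {B : BinaryTree Unit} (hB : B ≠ .nil) :
    branchCard c B = branchLength c B + 1 := by
  have h : ((vertices B).filter fun v => ∀ d ∈ v, d = c) =
      insert [] ((vertices B).filter fun v => v ≠ [] ∧ ∀ d ∈ v, d = c) := by
    ext v
    cases v <;> simp [nil_mem_vertices hB]
  rw [branchCard, h, Finset.card_insert_of_notMem (by simp), branchLength]

theorem branchLength_node (c : Bool) (l r : BinaryTree Unit) :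
    branchLength c (.node () l r) = branchCard c (if c then r else l) := by
  rw [branchLength, branchCard, ← Finset.card_image_of_injective
    ((vertices (if c then r else l)).filter _) (List.cons_injective (a := c))]
  congr 1
  simp only [vertices, Finset.filter_insert, Finset.filter_union, Finset.filter_image]
  cases c <;> simp

/-- The contribution of a subtree hanging from an edge in direction `c` to the coefficient
of the generating function. -/
noncomputable def edgeWeight (B : BinaryTree Unit) (c : Bool) : ℚ :=
  ((hookProd (edgeVertices false c B) : ℚ) * hookProd (edgeVertices true c B))⁻¹

/-- The proportion of labellings of `B` that are decreasing. -/
noncomputable def treeWeight (B : BinaryTree Unit) : ℚ :=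
  ((hookProd (dirVertices false B) : ℚ) * hookProd (dirVertices true B))⁻¹

theorem treeWeight_node (l r : BinaryTree Unit) :
    treeWeight (.node () l r) = edgeWeight l false * edgeWeight r true := by
  rw [treeWeight, edgeWeight, edgeWeight, hookProd_dirVertices_node, hookProd_dirVertices_node,
    ← mul_inv]
  push_cast
  ring

theorem edgeWeight_nil (c : Bool) : edgeWeight .nil c = 1 := by
  simp [edgeWeight, edgeVertices_nil, hookProd]

/-- The edge turns the root of `B` into a child in direction `c`, above all others; its hook is the
extra factor. The other direction is unaffected. -/
theorem edgeWeight_mul_card (c : Bool) {B : BinaryTree Unit} (hB : B ≠ .nil) :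
    edgeWeight B c * ((dirVertices c B).card + 1) = treeWeight B := by
  have h1 : (hookProd (dirVertices false B) : ℚ) ≠ 0 := by exact_mod_cast hookProd_ne_zero _
  have h2 : (hookProd (dirVertices true B) : ℚ) ≠ 0 := by exact_mod_cast hookProd_ne_zero _
  have h3 : ((dirVertices c B).card + 1 : ℚ) ≠ 0 := by positivity
  cases c
  · rw [edgeWeight, hookProd_edgeVertices_self _ hB, edgeVertices_of_ne (by simp), treeWeight]
    push_cast
    field_simp
  · rw [edgeWeight, hookProd_edgeVertices_self _ hB, edgeVertices_of_ne (by simp), treeWeight]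
    push_cast
    field_simp

/-- The non-ambiguous trees of shape `B` are pairs of labellings. -/
def natEquiv (B : BinaryTree Unit) :
    NAT B ≃ {f : leftVertices B → ℕ // IsDecreasingLabelling (leftVertices B) f} ×
      {f : rightVertices B → ℕ // IsDecreasingLabelling (rightVertices B) f} where
  toFun T := (⟨T.leftLabel, T.left_labelling⟩, ⟨T.rightLabel, T.right_labelling⟩)
  invFun p := ⟨p.1.1, p.2.1, p.1.2, p.2.2⟩

theorem finite_nat (B : BinaryTree Unit) : Finite (NAT B) :=
  have := finite_isDecreasingLabelling (leftVertices B)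
  have := finite_isDecreasingLabelling (rightVertices B)
  .of_equiv _ (natEquiv B).symm

theorem card_nat_mul_inv_factorial (B : BinaryTree Unit) :
    (Nat.card (NAT B) : ℚ) * (((leftVertices B).card.factorial *
      (rightVertices B).card.factorial : ℕ) : ℚ)⁻¹ = treeWeight B := by
  have h1 : (hookProd (dirVertices false B) : ℚ) ≠ 0 := by exact_mod_cast hookProd_ne_zero _
  have h2 : (hookProd (dirVertices true B) : ℚ) ≠ 0 := by exact_mod_cast hookProd_ne_zero _
  have hl := card_isDecreasingLabelling_mul_prod_hook (leftVertices B)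
  have hr := card_isDecreasingLabelling_mul_prod_hook (rightVertices B)
  have hl0 := (leftVertices B).card.factorial_ne_zero
  have hr0 := (rightVertices B).card.factorial_ne_zero
  rw [← hl] at hl0
  rw [← hr] at hr0
  rw [Nat.card_congr (natEquiv B), Nat.card_prod, ← hl, ← hr, treeWeight]
  -- `dirVertices false` and `dirVertices true` unfold to `leftVertices` and `rightVertices`.
  change _ = ((↑(∏ v ∈ leftVertices B, hook (leftVertices B) v) : ℚ) *
    ↑(∏ v ∈ rightVertices B, hook (rightVertices B) v))⁻¹
  have hl1 := left_ne_zero_of_mul hl0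
  have hl2 := right_ne_zero_of_mul hl0
  have hr1 := left_ne_zero_of_mul hr0
  have hr2 := right_ne_zero_of_mul hr0
  rw [← Nat.cast_ne_zero (R := ℚ)] at hl1 hl2 hr1 hr2
  simp only [Nat.cast_mul]
  field_simp

end Statistics

end NonAmbiguous

namespace NonAmbiguous

open MvPowerSeries

/-! ### Coefficients of the closed form as sums over trees. -/

section BranchSums

/-- The variable marking the children in direction `c`. -/
def dirIndex (c : Bool) : Fin 2 := if c then 1 else 0

theorem dirIndex_ne (c : Bool) : dirIndex c ≠ dirIndex (!c) := by
  cases c <;> decide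

/-- The bidegree of the monomial of a tree. -/
noncomputable def treeDegree (B : BinaryTree Unit) : Fin 2 →₀ ℕ :=
  Finsupp.single 0 (dirVertices false B).card + Finsupp.single 1 (dirVertices true B).card

/-- The bidegree of the monomial of a subtree hanging from an edge in direction `c`. -/
noncomputable def edgeDegree (c : Bool) (B : BinaryTree Unit) : Fin 2 →₀ ℕ :=
  Finsupp.single 0 (edgeVertices false c B).card + Finsupp.single 1 (edgeVertices true c B).card

theorem treeDegree_node (l r : BinaryTree Unit) :
    treeDegree (.node () l r) = edgeDegree false l + edgeDegree true r := by
  simp only [treeDegree, edgeDegree, card_dirVertices_node, Finsupp.single_add]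
  abel

theorem edgeDegree_nil (c : Bool) : edgeDegree c .nil = 0 := by
  simp [edgeDegree, edgeVertices_nil]

theorem edgeDegree_of_ne_nil (c : Bool) {B : BinaryTree Unit} (hB : B ≠ .nil) :
    edgeDegree c B = treeDegree B + Finsupp.single (dirIndex c) 1 := by
  cases c
  · rw [edgeDegree, card_edgeVertices_self _ hB, edgeVertices_of_ne (by simp), treeDegree,
      Finsupp.single_add]
    simp only [dirIndex, Bool.false_eq_true, if_false]
    abel
  · rw [edgeDegree, card_edgeVertices_self _ hB, edgeVertices_of_ne (by simp), treeDegree,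
      Finsupp.single_add]
    simp only [dirIndex, if_true]
    abel

theorem treeDegree_apply (c : Bool) (B : BinaryTree Unit) :
    treeDegree B (dirIndex c) = (dirVertices c B).card := by
  cases c <;> simp [treeDegree, dirIndex]

/-- With the hanging edge counted, each vertex is a child in exactly one direction. So `treesLE n`
holds all trees relevant up to degree `n`. -/
theorem degree_edgeDegree (c : Bool) (B : BinaryTree Unit) :
    (edgeDegree c B).degree = B.numNodes := by
  induction B generalizing c with
  | nil => simp [edgeDegree_nil]
  | node a l r hl hr =>
    rw [edgeDegree_of_ne_nil c (by simp), treeDegree_node, map_add, map_add, hl, hr]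
    simp

theorem degree_treeDegree_add_one {B : BinaryTree Unit} (hB : B ≠ .nil) :
    (treeDegree B).degree + 1 = B.numNodes := by
  rw [← degree_edgeDegree false, edgeDegree_of_ne_nil _ hB, map_add]
  simp

variable {R : Type*} [CommRing R] [Algebra ℚ R]

/-- The binary trees with at most `n` vertices. -/
def treesLE (n : ℕ) : Finset (BinaryTree Unit) :=
  (Finset.range (n + 1)).biUnion BinaryTree.treesOfNumNodesEq

theorem mem_treesLE {n : ℕ} {B : BinaryTree Unit} : B ∈ treesLE n ↔ B.numNodes ≤ n := by
  simp [treesLE]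

/-- The coefficient contributed by all labellings of a tree, with branch weights `γ`. -/
noncomputable def treeCoeff (γ : Bool → R) (B : BinaryTree Unit) : R :=
  treeWeight B • (γ false ^ branchLength false B * γ true ^ branchLength true B)

/-- The coefficient contributed by a subtree hanging from an edge in direction `c`, where the
vertices of its branch in direction `c` have weight `a`. -/
noncomputable def edgeCoeff (c : Bool) (a : R) (B : BinaryTree Unit) : R :=
  edgeWeight B c • a ^ branchCard c B

theorem treeCoeff_node (γ : Bool → R) (l r : BinaryTree Unit) :
    treeCoeff γ (.node () l r) = edgeCoeff false (γ false) l * edgeCoeff true (γ true) r := by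
  simp only [treeCoeff, edgeCoeff, treeWeight_node, branchLength_node, smul_mul_smul_comm]
  simp

/-- Tree counterpart of `coeff_branchSeries_add_single`: the root yields the factor `a`, the branch
in direction `c` keeps weight `a`, and the opposite branch gets weight `1`. -/
theorem edgeCoeff_mul_card (c : Bool) (a : R) {B : BinaryTree Unit} (hB : B ≠ .nil) :
    edgeCoeff c a B * ((dirVertices c B).card + 1) =
      a * treeCoeff (Function.update 1 c a) B := by
  have h : ((dirVertices c B).card + 1 : R) =
      algebraMap ℚ R ((dirVertices c B).card + 1) := by simp
  rw [edgeCoeff, treeCoeff, ← edgeWeight_mul_card c hB, branchCard_of_ne_nil c hB, h,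
    ← Algebra.commutes, ← Algebra.smul_def, smul_smul, mul_comm (edgeWeight B c),
    mul_smul_comm]
  cases c <;> simp [pow_succ']

/-- A non-empty tree is a pair of hanging subtrees, so its series is a product. The values for
subtrees are a hypothesis so that the induction in `sum_edgeCoeff_eq` can call this lemma. -/
theorem sum_treeCoeff_eq (γ : Bool → R) {n : ℕ} {d : Fin 2 →₀ ℕ} (hd : d.degree ≤ n)
    (ih : ∀ (c : Bool) (a : R) (e : Fin 2 →₀ ℕ), e.degree ≤ n →
      ∑ B ∈ treesLE n with edgeDegree c B = e, edgeCoeff c a B =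
        coeff e (branchSeries a (dirIndex c))) :
    ∑ B ∈ treesLE (n + 1) with B ≠ .nil ∧ treeDegree B = d, treeCoeff γ B =
      coeff d (branchSeries (γ false) 0 * branchSeries (γ true) 1) := by
  classical
  have h1 : ∑ B ∈ treesLE (n + 1) with B ≠ .nil ∧ treeDegree B = d, treeCoeff γ B =
      ∑ p ∈ treesLE n ×ˢ treesLE n with edgeDegree false p.1 + edgeDegree true p.2 = d,
        edgeCoeff false (γ false) p.1 * edgeCoeff true (γ true) p.2 := by
    symm
    refine Finset.sum_bij (fun p _ ↦ .node () p.1 p.2) ?_ ?_ ?_ ?_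
    · rintro ⟨l, r⟩ hp
      rw [Finset.mem_filter] at hp ⊢
      have hdeg := congrArg Finsupp.degree hp.2
      rw [map_add, degree_edgeDegree, degree_edgeDegree] at hdeg
      rw [mem_treesLE, treeDegree_node, BinaryTree.numNodes]
      exact ⟨by lia, by simp, hp.2⟩
    · rintro ⟨l, r⟩ - ⟨l', r'⟩ - h
      simpa using h
    · rintro (_ | ⟨⟨⟩, l, r⟩) hB
      · simp at hB
      · rw [Finset.mem_filter, mem_treesLE, treeDegree_node, BinaryTree.numNodes] at hB
        refine ⟨(l, r), ?_, rfl⟩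
        rw [Finset.mem_filter, Finset.mem_product, mem_treesLE, mem_treesLE]
        exact ⟨⟨by lia, by lia⟩, hB.2.2⟩
    · rintro ⟨l, r⟩ -
      rw [treeCoeff_node]
  have h2 : ∀ p ∈ Finset.HasAntidiagonal.antidiagonal d,
      coeff p.1 (branchSeries (γ false) 0) * coeff p.2 (branchSeries (γ true) 1) =
        ∑ q ∈ treesLE n ×ˢ treesLE n with (edgeDegree false q.1, edgeDegree true q.2) = p,
          edgeCoeff false (γ false) q.1 * edgeCoeff true (γ true) q.2 := by
    rintro ⟨e, e'⟩ hp
    have hdeg := congrArg Finsupp.degree (Finset.HasAntidiagonal.mem_antidiagonal.mp hp)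
    rw [map_add] at hdeg
    have hl := ih false (γ false) e (by lia)
    have hr := ih true (γ true) e' (by lia)
    simp only [dirIndex, Bool.false_eq_true, if_false, if_true] at hl hr
    rw [← hl, ← hr, Finset.sum_mul_sum, ← Finset.sum_product', ← Finset.filter_product]
    simp only [Prod.mk.injEq]
  rw [h1, coeff_mul, Finset.sum_congr rfl h2, Finset.sum_fiberwise_eq_sum_filter]
  simp only [Finset.HasAntidiagonal.mem_antidiagonal]

theorem sum_edgeCoeff_eq (n : ℕ) (c : Bool) (a : R) (d : Fin 2 →₀ ℕ) (hd : d.degree ≤ n) :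
    ∑ B ∈ treesLE n with edgeDegree c B = d, edgeCoeff c a B =
      coeff d (branchSeries a (dirIndex c)) := by
  classical
  -- A non-empty hanging subtree has positive degree in direction `c`, so here only the empty tree
  -- can count.
  by_cases hdc : d (dirIndex c) = 0
  · have h : ∀ B, edgeDegree c B = d → B = .nil := fun B hB ↦ by
      by_contra hne
      rw [edgeDegree_of_ne_nil c hne] at hB
      rw [← hB] at hdc
      simp at hdc
    have hnil : edgeCoeff c a .nil = 1 := by
      simp [edgeCoeff, edgeWeight_nil, branchCard_nil]
    rw [coeff_branchSeries_of_eq_zero a _ hdc]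
    split_ifs with hd0
    · rw [← hnil]
      refine Finset.sum_eq_single_of_mem _ ?_ fun B hB hne ↦
        absurd (h B (Finset.mem_filter.mp hB).2) hne
      simp [mem_treesLE, edgeDegree_nil, hd0]
    · refine Finset.sum_eq_zero fun B hB ↦ absurd ?_ hd0
      have hB' := (Finset.mem_filter.mp hB).2
      rw [← hB', h B hB', edgeDegree_nil]
  · obtain ⟨e, rfl⟩ : ∃ e, d = e + Finsupp.single (dirIndex c) 1 :=
      ⟨d - Finsupp.single (dirIndex c) 1, (tsub_add_cancel_of_le (by
        rw [Finsupp.single_le_iff]; lia)).symm⟩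
    cases n with
    | zero => simp at hd
    | succ n =>
      have he : e.degree ≤ n := by simpa [map_add] using hd
      have hfilter : ((treesLE (n + 1)).filter fun B ↦
          edgeDegree c B = e + Finsupp.single (dirIndex c) 1) =
          (treesLE (n + 1)).filter fun B ↦ B ≠ .nil ∧ treeDegree B = e := by
        refine Finset.filter_congr fun B _ ↦ ?_
        by_cases hB : B = .nil
        · subst hB
          simp only [ne_eq, not_true_eq_false, false_and, iff_false, edgeDegree_nil]
          intro h
          simpa using congrArg (· (dirIndex c)) h
        · rw [edgeDegree_of_ne_nil c hB, add_left_inj]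
          simp [hB]
      -- Both sides are compared after applying `∂_i`; its integer factor can be cancelled over `ℚ`.
      have hunit : IsUnit ((e (dirIndex c) : R) + 1) := by
        have h := (IsUnit.mk0 ((e (dirIndex c) : ℚ) + 1) (by positivity)).map (algebraMap ℚ R)
        simpa using h
      refine hunit.mul_right_cancel ?_
      rw [coeff_branchSeries_add_single a (dirIndex_ne c), hfilter, Finset.sum_mul]
      have hprod : branchSeries a (dirIndex c) * branchSeries 1 (dirIndex !c) =
          branchSeries (Function.update (1 : Bool → R) c a false) 0 *
            branchSeries (Function.update (1 : Bool → R) c a true) 1 := by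
        cases c
        · simp [dirIndex]
        · simp [dirIndex, mul_comm]
      rw [hprod, ← sum_treeCoeff_eq _ he fun c a e he ↦ sum_edgeCoeff_eq n c a e he,
        Finset.mul_sum]
      refine Finset.sum_congr rfl fun B hB ↦ ?_
      obtain ⟨-, hne, rfl⟩ := Finset.mem_filter.mp hB
      rw [treeDegree_apply, edgeCoeff_mul_card c a hne]

end BranchSums

/-! ### Coefficientwise convergence of the sum over labelled trees. -/

section FormalSum

variable {R : Type*} [CommRing R] [Algebra ℚ R]

theorem coeff_natTerm (α β : R) (T : NonAmbiguousTree) (d : Fin 2 →₀ ℕ) :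
    coeff d (natTerm α β T) = if treeDegree T.shape = d then
      ((((leftVertices T.shape).card.factorial *
        (rightVertices T.shape).card.factorial : ℕ) : ℚ)⁻¹) •
          (α ^ leftmostLength T.shape * β ^ rightmostLength T.shape) else 0 := by
  classical
  have h : (X 0 ^ (leftVertices T.shape).card * X 1 ^ (rightVertices T.shape).card :
      MvPowerSeries (Fin 2) R) = monomial (treeDegree T.shape) 1 := by
    rw [X_pow_eq, X_pow_eq, monomial_mul_monomial, one_mul]
    rfl
  rw [natTerm, h, mul_comm (monomial _ _), ← smul_eq_C_mul, ← algebraMap_smul R, map_smul, map_smul,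
    coeff_monomial, smul_eq_mul, smul_eq_mul, Algebra.smul_def]
  simp [eq_comm]

/-- A tree of degree `d` has `d.degree + 1` vertices, so each coefficient is a finite sum, over
finitely many shapes with finitely many labellings. -/
theorem hasFormalSum_natTerm (α β : R) :
    HasFormalSum (natTerm α β) (branchSeries α 0 * branchSeries β 1) := by
  classical
  let : TopologicalSpace R := ⊥
  refine WithPiTopology.hasSum_iff_hasSum_coeff.mpr fun d ↦ ?_
  have := fun B ↦ finite_nat B
  let := fun B ↦ Fintype.ofFinite (NAT B)
  set s : Finset (BinaryTree Unit) :=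
    (treesLE (d.degree + 1)).filter fun B ↦ B ≠ .nil ∧ treeDegree B = d with hs
  have hmem : ∀ B, B ∈ s ↔ B ≠ .nil ∧ treeDegree B = d := fun B ↦ by
    rw [hs, Finset.mem_filter, mem_treesLE]
    refine ⟨fun h ↦ h.2, fun h ↦ ⟨?_, h⟩⟩
    rw [← degree_treeDegree_add_one h.1, h.2]
  have hsum : coeff d (branchSeries α 0 * branchSeries β 1) =
      ∑ T ∈ (s.subtype fun B ↦ B ≠ .nil).sigma fun _ ↦ Finset.univ,
        coeff d (natTerm α β T) := by
    have h := sum_treeCoeff_eq (fun c ↦ if c then β else α) (le_refl d.degree)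
      fun c a e he ↦ sum_edgeCoeff_eq _ c a e he
    simp only [Bool.false_eq_true, if_false, if_true] at h
    rw [← h, Finset.sum_sigma, ← hs, ← Finset.sum_subtype_of_mem _ fun B hB ↦ ((hmem B).mp hB).1]
    refine Finset.sum_congr rfl fun B hB ↦ ?_
    have hB' := ((hmem B).mp (Finset.mem_subtype.mp hB)).2
    -- The term depends only on the shape, so the labellings contribute their number, which
    -- `card_nat_mul_inv_factorial` converts to the hook weight.
    simp only [coeff_natTerm, NonAmbiguousTree.shape, hB', if_true, Finset.sum_const,
      Finset.card_univ, treeCoeff, ← card_nat_mul_inv_factorial, Nat.card_eq_fintype_card]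
    rw [mul_smul, Nat.cast_smul_eq_nsmul]
    rfl
  rw [hsum]
  refine hasSum_sum_of_ne_finset_zero fun T hT ↦ ?_
  rw [coeff_natTerm, if_neg]
  intro h
  refine hT (Finset.mem_sigma.mpr ⟨Finset.mem_subtype.mpr ((hmem _).mpr ⟨T.1.2, h⟩), ?_⟩)
  exact Finset.mem_univ _

end FormalSum

end NonAmbiguous

open NonAmbiguous MvPowerSeries in
theorem mainTheorem1 {R : Type*} [CommRing R] [Algebra ℚ R] (α β : R) :
    IsUnit (fpow (1 - (fexp (X 0) - 1) * (fexp (X 1) - 1)) (α + β)) ∧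
    HasFormalSum (natTerm α β)
      (fexp (C α * X 0 + C β * X 1) *
        Ring.inverse (fpow (1 - (fexp (X 0) - 1) * (fexp (X 1) - 1)) (α + β))) := by
  refine ⟨isUnit_fpow constantCoeff_denominator _, ?_⟩
  have h := hasFormalSum_natTerm α β
  rwa [← fexp_mul_inverse_fpow_denominator] at h
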